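/- Let $E$ be a finite set, let $\langle E\mid\rangle$ be the free group on $E$, and let $Z$ be a finite subset of $\langle E\mid\rangle$. A basis of a subgroup of $\langle E\mid\rangle$ is a free-generating set of it. Let $E_Z=\operatorname{supp}(Z\ \mathrm{rel}\ E)$ denote the smallest subset of $E$ such that $Z\subseteq\langle E_Z\rangle$, and let $\operatorname{Cl}(Z)$ denote the intersection of all the free-product factors of $\langle E\mid\rangle$ that contain $Z$. (A free-product factor is a subgroup $K$ such that $\langle E\mid\rangle=K*L$ for some subgroup $L$.) Let $\operatorname{Wh}(Z\ \mathrm{rel}\ E_Z)$ be the graph with vertex set $E_Z\cup E_Z^{-1}\cup\{1\}$ whose edges are the pairs $(e_i^{-1},e_{i+1})$, $0\le i\le n$, where $e_1e_2\cdots e_n$ ranges over the reduced $E^{\pm1}$-expressions of the elements $z\in Z\setminus\{1\}$ and $e_0=e_{n+1}=1$. A vertex $e_\star\neq 1$ of this graph is a Whitehead cut-vertex if removing $e_\star$ and all edges incident to it leaves a graph that is not connected, where the directions of edges are disregarded. Suppose that $\operatorname{Wh}(Z\ \mathrm{rel}\ E_Z)$ has no Whitehead cut-vertices. Then $\operatorname{Cl}(Z)$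 is the smallest free-product factor of $\langle E\mid\rangle$ that contains $Z$, and $E_Z$ is a basis of $\operatorname{Cl}(Z)$. Moreover, for each free-product factorization $\operatorname{Cl}(Z)=\ast_{i\in I}H_i$ such that $Z\subseteq\bigcup_{i\in I}H_i$, the set $E_Z$ contains a basis of each $H_i$. -/

import Mathlib

/-- `G ⊇ K = ∗ H i`: the canonical homomorphism from the abstract free product of the
subgroups `H i` to `G` is injective and has image `K`. -/
def IsFreeProduct {G : Type*} [Group G] {ι : Type*} (H : ι → Subgroup G) (K : Subgroup G) : Prop :=
  Function.Injective (Monoid.CoprodI.lift fun i => (H i).subtype) ∧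
    (Monoid.CoprodI.lift fun i => (H i).subtype).range = K

/-- `K` is a free-product factor of `G`: there is a subgroup `L` with `G = K ∗ L`. -/
def IsFreeFactor {G : Type*} [Group G] (K : Subgroup G) : Prop :=
  ∃ L : Subgroup G, IsFreeProduct ![K, L] ⊤

/-- `B` is a basis (a free-generating set) of the subgroup `K`: the canonical homomorphism from
the free group on `B` to `G` is injective and has image `K`. -/
def IsBasisOf {G : Type*} [Group G] (B : Set G) (K : Subgroup G) : Prop :=
  Function.Injective (FreeGroup.lift fun b : B => (b : G)) ∧
    (FreeGroup.lift fun b : B => (b : G)).range = K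

/-- `Cl(Z)`: the intersection of all free-product factors that contain `Z`. -/
def freeClosure {G : Type*} [Group G] (Z : Set G) : Subgroup G :=
  sInf {K : Subgroup G | IsFreeFactor K ∧ Z ⊆ K}

/-- `supp(Z rel E)`, for `E` the standard basis of the free group on `α`, as a set of indices:
the smallest `S ⊆ α` such that `Z` lies in the subgroup generated by the generators with index
in `S` (see `isLeast_supp`). -/
def supp {α : Type*} (Z : Set (FreeGroup α)) : Set α :=
  ⋂₀ {S : Set α | Z ⊆ Subgroup.closure (FreeGroup.of '' S)}

/-- `E_Z`, that is, `supp(Z rel E)` as a set of elements of the free group. -/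
def suppBasis {α : Type*} (Z : Set (FreeGroup α)) : Set (FreeGroup α) :=
  FreeGroup.of '' supp Z

theorem mem_closure_of_image_iff {α : Type*} [DecidableEq α] (S : Set α) (z : FreeGroup α) :
    z ∈ Subgroup.closure (FreeGroup.of '' S) ↔ ∀ p ∈ z.toWord, p.1 ∈ S := by
  constructor
  · intro hz
    induction hz using Subgroup.closure_induction with
    | mem x hx =>
      obtain ⟨a, ha, rfl⟩ := hx
      simpa using ha
    | one => simp
    | mul x y _ _ hx hy =>
      intro p hp
      have h := (FreeGroup.toWord_mul_sublist x y).subset hp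
      rcases List.mem_append.1 h with h | h
      · exact hx p h
      · exact hy p h
    | inv x _ hx =>
      intro p hp
      rw [FreeGroup.toWord_inv, FreeGroup.invRev] at hp
      simp only [List.mem_reverse, List.mem_map] at hp
      obtain ⟨q, hq, rfl⟩ := hp
      exact hx q hq
  · intro h
    have key : ∀ L : List (α × Bool), (∀ p ∈ L, p.1 ∈ S) →
        FreeGroup.mk L ∈ Subgroup.closure (FreeGroup.of '' S) := by
      intro L
      induction L with
      | nil => intro _; exact Subgroup.one_mem _
      | cons p L ih =>
        intro hL
        have h1 : FreeGroup.mk (p :: L) = FreeGroup.mk [p] * FreeGroup.mk L := by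
          rw [FreeGroup.mul_mk]; rfl
        rw [h1]
        refine Subgroup.mul_mem _ ?_ (ih fun q hq => hL q (List.mem_cons_of_mem _ hq))
        have hp : FreeGroup.of p.1 ∈ Subgroup.closure (FreeGroup.of '' S) :=
          Subgroup.subset_closure ⟨p.1, hL p List.mem_cons_self, rfl⟩
        obtain ⟨a, b⟩ := p
        cases b
        · exact Subgroup.inv_mem _ hp
        · exact hp
    rw [← FreeGroup.mk_toWord (x := z)]
    exact key _ h

theorem isLeast_supp {α : Type*} (Z : Set (FreeGroup α)) :
    IsLeast {S : Set α | Z ⊆ Subgroup.closure (FreeGroup.of '' S)} (supp Z) := by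
  classical
  refine ⟨fun z hz => ?_, fun S hS => Set.sInter_subset_of_mem hS⟩
  refine (mem_closure_of_image_iff _ z).2 fun p hp => Set.mem_sInter.2 fun S hS => ?_
  exact (mem_closure_of_image_iff S z).1 (hS hz) p hp

/-- The set `B^{±1} ∪ {1}` for a set `B` of generators: `none` stands for `1`, `some (a, true)`
for the generator `a`, and `some (a, false)` for its inverse. -/
def whVertices {α : Type*} (B : Set α) : Set (Option (α × Bool)) :=
  {v | ∀ p, v = some p → p.1 ∈ B}

/-- The inversion on `E^{±1} ∪ {1}`. -/
def vertexInv {α : Type*} (v : Option (α × Bool)) : Option (α × Bool) :=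
  v.map fun p => (p.1, !p.2)

/-- The sequence `e_0, e_1, …, e_n, e_{n+1}`, where `e_1 ⋯ e_n` is the reduced expression of `z`
and `e_0 = e_{n+1} = 1`. -/
def paddedWord {α : Type*} [DecidableEq α] (z : FreeGroup α) : List (Option (α × Bool)) :=
  none :: (z.toWord.map some ++ [none])

/-- The Whitehead graph `Wh(Z rel B)`, for `Z` contained in the subgroup generated by `B`. Its
vertex set is `B^{±1} ∪ {1}`, and its directed edges are the pairs `(e_i⁻¹, e_{i+1})`, where
`e_i, e_{i+1}` are consecutive in the padded reduced expression of some element `z ≠ 1` of `Z`. -/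
def whGraph {α : Type*} [DecidableEq α] (Z : Set (FreeGroup α)) (B : Set α) :
    Digraph (whVertices B) where
  Adj x y := ∃ z ∈ Z, z ≠ 1 ∧ ∃ u v : Option (α × Bool),
    [u, v] <:+: paddedWord z ∧ (x : Option (α × Bool)) = vertexInv u ∧ (y : Option (α × Bool)) = v

/-- A vertex `v` other than the basepoint `1` is a Whitehead cut-vertex of `Wh(Z rel B)` if
removing `v` and its incident edges leaves a graph that is not connected (as an undirected
graph). -/
def IsWhiteheadCutVertex {α : Type*} [DecidableEq α] (Z : Set (FreeGroup α)) (B : Set α)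
    (v : whVertices B) : Prop :=
  (v : Option (α × Bool)) ≠ none ∧
    ¬ ((whGraph Z B).toSimpleGraphInclusive.induce {w | w ≠ v}).Connected

/-! Everything rests on `exists_mem_of_no_cutVertex`: if a free product of subgroups `H i` contains
`F = ⟨E_Z⟩` and each element of `Z` lies in some `H i`, then each element of `E_Z` lies in some `H
i`.

Colour `g ∈ F` by the index of the first syllable of `w * g`, for a fixed `w` in the free product.
For fixed `h`, right multiplication by `h` changes the colour of only finitely many `g`.
Multiplication by `z ∈ Z` alters only the last syllable, so it keeps the colour unless an end
becomes trivial. In the Cayley tree of `F`, the colour is therefore constant along edges far from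
`1`. Constancy moves inwards: at a vertex other than `1`, the branches pointing away from `1` are
linked by translates of words of `Z`, because the Whitehead graph stays connected when the direction
back to `1` is removed. Hence the colour is constant on every edge not touching `1`
(`eq_mul_of_of_no_cutVertex`). A generator with at least two syllables would contradict this for a
suitable `w`.

Retracting onto a factor then gives `⟨E_Z⟩ ∩ H i = ⟨E_Z ∩ H i⟩` (`IsFreeProduct.mem_closure_inter`).
For a free factor `K ⊇ Z`, minimality of the support forces `E_Z ⊆ K`; for a factorization of
`Cl(Z)`, `E_Z ∩ H i` is a basis of `H i`. -/

theorem FreeGroup.mk_mem_closure_of_image {α : Type*} [DecidableEq α] {S : Set α}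
    {L : List (α × Bool)} (hL : ∀ p ∈ L, p.1 ∈ S) :
    FreeGroup.mk L ∈ Subgroup.closure (FreeGroup.of '' S) := by
  rw [mem_closure_of_image_iff, FreeGroup.toWord_mk]
  exact fun p hp => hL p (FreeGroup.Red.sublist FreeGroup.reduce.red |>.subset hp)

/-- Consecutive entries of a padded word come from a splitting of the word. -/
theorem exists_append_of_pair_infix {β : Type*} (L : List β) (o u w : Option β)
    (h : [u, w] <:+: o :: (L.map some ++ [none])) :
    ∃ L₁ L₂, L = L₁ ++ L₂ ∧ u = L₁.getLast?.or o ∧ w = L₂.head? := by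
  obtain ⟨A, B, h⟩ := h
  induction L generalizing o A with
  | nil =>
    match A with
    | [] => simp at h; exact ⟨[], [], by simp [h]⟩
    | [a] => simp at h
    | a :: b :: A => simp at h
  | cons p L ih =>
    match A with
    | [] => simp at h; exact ⟨[], p :: L, by simp [h]⟩
    | a :: A =>
      simp only [List.cons_append, List.map_cons, List.cons.injEq] at h
      obtain ⟨L₁, L₂, rfl, hu, hw⟩ := ih (some p) A (by simpa using h.2)
      refine ⟨p :: L₁, L₂, rfl, ?_, hw⟩
      rw [hu, List.getLast?_cons]
      cases L₁.getLast? <;> simp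

/-- A function that is constant along the edges of a connected graph is constant. -/
theorem SimpleGraph.Connected.eq_of_forall_adj {V T : Type*} {G : SimpleGraph V}
    (hG : G.Connected) (s : V → T) (hs : ∀ x y, G.Adj x y → s x = s y) (x y : V) : s x = s y := by
  obtain ⟨p⟩ := hG.preconnected x y
  induction p with
  | nil => rfl
  | cons h _ ih => exact (hs _ _ h).trans ih

/-- If a function `c` is constant beyond the neighbours of the vertex `V` on the far side of
`V ≠ 1` and respects right multiplication by `Z`, then it is constant near `V`, provided that the
direction back to `1` is not a cut-vertex. -/
theorem eq_append_singleton_of_not_cutVertex {α T : Type*} [DecidableEq α]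
    (Z : Set (FreeGroup α)) (hcut : ∀ v : whVertices (supp Z), ¬ IsWhiteheadCutVertex Z (supp Z) v)
    (c : FreeGroup α → T)
    (hZ : ∀ z ∈ Z, ∀ g ∈ Subgroup.closure (FreeGroup.of '' supp Z), g ≠ 1 → g * z ≠ 1 →
      c g = c (g * z))
    (V : List (α × Bool)) (x : α × Bool) (hVx : ∀ p ∈ V ++ [x], p.1 ∈ supp Z)
    (hfar : ∀ p W, FreeGroup.IsReduced (V ++ [x] ++ p :: W) → (∀ q ∈ p :: W, q.1 ∈ supp Z) →
      c (FreeGroup.mk (V ++ [x] ++ p :: W)) = c (FreeGroup.mk (V ++ [x] ++ [p])))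
    (p : α × Bool) (hp : p.1 ∈ supp Z) (hred : FreeGroup.IsReduced (V ++ [x] ++ [p])) :
    c (FreeGroup.mk (V ++ [x])) = c (FreeGroup.mk (V ++ [x] ++ [p])) := by
  set S := supp Z with hS
  have hxS : x.1 ∈ S := hVx x (by simp)
  have hVred : FreeGroup.IsReduced (V ++ [x]) := hred.infix ⟨[], [p], by simp⟩
  -- The letter `x⁻¹` is the direction from `Vx` back to `1`.
  let b : whVertices S := ⟨some (x.1, !x.2), by rintro q ⟨⟩; exact hxS⟩
  have hconn : ((whGraph Z S).toSimpleGraphInclusive.induce {w | w ≠ b}).Connected := by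
    by_contra hc
    exact hcut b ⟨by simp [b], hc⟩
  -- The colour of the branch at `Vx` in a given direction; `none` gives the colour of `Vx` itself.
  let s : Option (α × Bool) → T := fun o => c (FreeGroup.mk (V ++ [x] ++ o.toList))
  have append_red : ∀ W : List (α × Bool), FreeGroup.IsReduced W →
      W.head? ≠ some (x.1, !x.2) → FreeGroup.IsReduced (V ++ [x] ++ W) := by
    intro W hW hne
    match W with
    | [] => simpa using hVred
    | q :: W =>
      have h1 : FreeGroup.IsReduced ([x] ++ q :: W) := by
        simp only [List.singleton_append, FreeGroup.isReduced_cons_cons]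
        refine ⟨fun h => ?_, hW⟩
        by_contra h'
        apply hne
        simp only [List.head?_cons, Option.some.injEq]
        obtain ⟨x1, x2⟩ := x
        obtain ⟨q1, q2⟩ := q
        simp only at h h'
        subst h
        cases x2 <;> cases q2 <;> simp_all
      exact FreeGroup.IsReduced.append_overlap hVred h1 (by simp)
  have far : ∀ W : List (α × Bool), FreeGroup.IsReduced W → W.head? ≠ some (x.1, !x.2) →
      (∀ q ∈ W, q.1 ∈ S) → c (FreeGroup.mk (V ++ [x] ++ W)) = s W.head? := by
    intro W hW hne hWS
    match W with
    | [] => rfl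
    | q :: W => exact hfar q W (append_red _ hW hne) hWS
  -- An edge comes from a splitting `z = L₁L₂`. Right multiplication by `z` takes `VxL₁⁻¹` to
  -- `VxL₂`; both words are reduced, as neither leaves `Vx` towards `1`.
  have key : ∀ u v : whVertices S, u ≠ b → v ≠ b → (whGraph Z S).Adj u v → s u = s v := by
    rintro ⟨u, hu⟩ ⟨v, hv⟩ hub hvb ⟨z, hz, hz1, u', v', hinf, rfl, rfl⟩
    obtain ⟨L₁, L₂, hL, rfl, rfl⟩ := exists_append_of_pair_infix _ _ _ _ hinf
    have hzS : ∀ q ∈ z.toWord, q.1 ∈ S :=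
      (mem_closure_of_image_iff S z).1 ((isLeast_supp Z).1 hz)
    have hzred : FreeGroup.IsReduced (L₁ ++ L₂) := hL ▸ FreeGroup.isReduced_toWord
    have hhead : vertexInv (L₁.getLast?.or none) = (FreeGroup.invRev L₁).head? := by
      simp [vertexInv, FreeGroup.invRev, List.head?_reverse, List.getLast?_map]
    have hL1red : FreeGroup.IsReduced (FreeGroup.invRev L₁) := by
      rw [FreeGroup.isReduced_iff_reduce_eq, FreeGroup.reduce_invRev,
        (hzred.infix ⟨[], L₂, by simp⟩).reduce_eq]
    have hL2red : FreeGroup.IsReduced L₂ := hzred.infix ⟨L₁, [], by simp⟩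
    have hL1S : ∀ q ∈ FreeGroup.invRev L₁, q.1 ∈ S := by
      intro q hq
      simp only [FreeGroup.invRev, List.mem_reverse, List.mem_map] at hq
      obtain ⟨r, hr, rfl⟩ := hq
      exact hzS r (by simp [hL, hr])
    have hL2S : ∀ q ∈ L₂, q.1 ∈ S := fun q hq => hzS q (by simp [hL, hq])
    have hne1 : (FreeGroup.invRev L₁).head? ≠ some (x.1, !x.2) := by
      rw [← hhead]; exact fun h => hub (Subtype.ext h)
    have hne2 : L₂.head? ≠ some (x.1, !x.2) := fun h => hvb (Subtype.ext h)
    have ne_one : ∀ W, FreeGroup.IsReduced (V ++ [x] ++ W) →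
        FreeGroup.mk (V ++ [x] ++ W) ≠ 1 := by
      intro W hW h
      rw [← FreeGroup.toWord_eq_nil_iff, FreeGroup.toWord_mk, hW.reduce_eq] at h
      simp at h
    have hmul : FreeGroup.mk (V ++ [x] ++ FreeGroup.invRev L₁) * z =
        FreeGroup.mk (V ++ [x] ++ L₂) := by
      rw [← FreeGroup.mk_toWord (x := z), hL, ← FreeGroup.mul_mk, ← FreeGroup.mul_mk,
        ← FreeGroup.mul_mk, ← FreeGroup.inv_mk, ← FreeGroup.mul_mk, ← FreeGroup.mul_mk]
      group
    simp only [hhead]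
    rw [← far _ hL1red hne1 hL1S, ← far _ hL2red hne2 hL2S, ← hmul]
    refine hZ z hz _ ?_ (ne_one _ (append_red _ hL1red hne1)) ?_
    · refine FreeGroup.mk_mem_closure_of_image fun q hq => ?_
      rcases List.mem_append.1 hq with hq | hq
      exacts [hVx q hq, hL1S q hq]
    · rw [hmul]
      exact ne_one _ (append_red _ hL2red hne2)
  have hpb : (some p : Option (α × Bool)) ≠ some (x.1, !x.2) := by
    intro h
    have h2 : FreeGroup.IsReduced (x :: [p]) := hred.infix ⟨V, [], by simp⟩
    obtain rfl : p = (x.1, !x.2) := by simpa using h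
    rw [FreeGroup.isReduced_cons_cons] at h2
    simpa using h2.1
  have := hconn.eq_of_forall_adj (fun v => s v.1.1) (by
    rintro ⟨u, hu⟩ ⟨v, hv⟩ h
    rcases h.2 with h | h
    · exact key u v hu hv h
    · exact (key v u hv hu h).symm)
    ⟨⟨none, by rintro q ⟨⟩⟩, fun h => by simpa [b] using congrArg Subtype.val h⟩
    ⟨⟨some p, by rintro q ⟨⟩; exact hp⟩, fun h => hpb (congrArg Subtype.val h)⟩
  simpa [s] using this

/-- If `Wh(Z rel E_Z)` has no Whitehead cut-vertices, then every function on `⟨E_Z⟩` with finite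
coboundary that is invariant under right multiplication by `Z` away from `1` is invariant under
right multiplication by `E_Z` away from `1`. -/
theorem eq_mul_of_of_no_cutVertex {α T : Type*} [Finite α] [DecidableEq α]
    (Z : Set (FreeGroup α)) (hcut : ∀ v : whVertices (supp Z), ¬ IsWhiteheadCutVertex Z (supp Z) v)
    (c : FreeGroup α → T)
    (hfin : ∀ h ∈ Subgroup.closure (FreeGroup.of '' supp Z),
      {g | g ∈ Subgroup.closure (FreeGroup.of '' supp Z) ∧ c g ≠ c (g * h)}.Finite)
    (hZ : ∀ z ∈ Z, ∀ g ∈ Subgroup.closure (FreeGroup.of '' supp Z), g ≠ 1 → g * z ≠ 1 →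
      c g = c (g * z))
    {g : FreeGroup α} (hg : g ∈ Subgroup.closure (FreeGroup.of '' supp Z)) {a : α}
    (ha : a ∈ supp Z) (hg1 : g ≠ 1) (hga : g * FreeGroup.of a ≠ 1) :
    c g = c (g * FreeGroup.of a) := by
  set S := supp Z with hS
  have hltr : ∀ p : α × Bool, p.1 ∈ S →
      FreeGroup.mk [p] ∈ Subgroup.closure (FreeGroup.of '' S) := fun p hp =>
    FreeGroup.mk_mem_closure_of_image (by simpa using hp)
  obtain ⟨N, hN⟩ : ∃ N : ℕ, ∀ p : α × Bool, p.1 ∈ S →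
      ∀ g ∈ Subgroup.closure (FreeGroup.of '' S), c g ≠ c (g * FreeGroup.mk [p]) →
        g.norm < N := by
    have hfin' : (⋃ p : {p : α × Bool // p.1 ∈ S},
        {g | g ∈ Subgroup.closure (FreeGroup.of '' S) ∧ c g ≠ c (g * FreeGroup.mk [p.1])}).Finite :=
      Set.finite_iUnion fun p => hfin _ (hltr p.1 p.2)
    obtain ⟨N, hN⟩ := (hfin'.image FreeGroup.norm).bddAbove
    refine ⟨N + 1, fun p hp g hg hc => Nat.lt_succ_of_le (hN ⟨g, ?_, rfl⟩)⟩
    exact Set.mem_iUnion.2 ⟨⟨p, hp⟩, hg, hc⟩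
  -- Downward induction on the distance `n` from `1`, starting beyond the bound `N`. It stops at `n
  -- = 1`, since a last letter `x` is needed to point back to `1`.
  have main : ∀ k n, n + k = N + 1 → 1 ≤ n → ∀ (V : List (α × Bool)) (p : α × Bool),
      FreeGroup.IsReduced (V ++ [p]) → (∀ q ∈ V ++ [p], q.1 ∈ S) → n ≤ V.length →
      c (FreeGroup.mk V) = c (FreeGroup.mk (V ++ [p])) := by
    intro k
    induction k with
    | zero =>
      intro n hn _ V p hred hVS hlen
      by_contra hc
      rw [← FreeGroup.mul_mk] at hc
      have := hN p (hVS p (by simp)) (FreeGroup.mk V)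
        (FreeGroup.mk_mem_closure_of_image fun q hq => hVS q (by simp [hq])) hc
      rw [FreeGroup.norm, FreeGroup.toWord_mk,
        (hred.infix ⟨[], [p], by simp⟩ : FreeGroup.IsReduced V).reduce_eq] at this
      omega
    | succ k ih =>
      intro n hn hn1 V p hred hVS hlen
      have ih' := ih (n + 1) (by omega) (by omega)
      obtain ⟨V, x, rfl⟩ : ∃ V' x, V = V' ++ [x] := by
        rcases List.eq_nil_or_concat V with rfl | ⟨V', x, h⟩
        · simp at hlen; omega
        · exact ⟨V', x, by simpa using h⟩
      refine eq_append_singleton_of_not_cutVertex Z hcut c hZ V x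
        (fun q hq => hVS q (List.mem_append_left _ hq)) ?_ p (hVS p (by simp)) hred
      intro p' W
      induction W using List.reverseRecOn with
      | nil => intros; rfl
      | append_singleton W q ihW =>
        intro hr hW
        have e : V ++ [x] ++ p' :: (W ++ [q]) = (V ++ [x] ++ p' :: W) ++ [q] := by simp
        rw [e] at hr ⊢
        rw [← ih' _ q hr ?_ (by simp at hlen ⊢; omega)]
        · exact ihW (hr.infix ⟨[], [q], by simp⟩) fun r hr => hW r (by
            rw [List.mem_cons] at hr ⊢; simp; tauto)
        · rw [← e]
          intro r hr
          rcases List.mem_append.1 hr with hr | hr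
          exacts [hVS r (List.mem_append_left _ hr), hW r hr]
  have hgS := (mem_closure_of_image_iff S g).1 hg
  have step : ∀ (V : List (α × Bool)) (p : α × Bool),
      FreeGroup.IsReduced (V ++ [p]) → (∀ q ∈ V ++ [p], q.1 ∈ S) → V ≠ [] →
      c (FreeGroup.mk V) = c (FreeGroup.mk (V ++ [p])) := fun V p h1 h2 h3 =>
    main N 1 (by omega) le_rfl V p h1 h2 (List.length_pos_iff.2 h3)
  by_cases hr : FreeGroup.IsReduced (g.toWord ++ [(a, true)])
  · have := step g.toWord (a, true) hr (by
      intro q hq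
      rcases List.mem_append.1 hq with hq | hq
      · exact hgS q hq
      · simp at hq; subst hq; exact ha) (by simpa using hg1)
    rwa [← FreeGroup.mul_mk, FreeGroup.mk_toWord] at this
  -- Here `a` cancels the last letter of `g`, so the edge is read from its other end.
  · obtain ⟨V, hV⟩ : ∃ V, g.toWord = V ++ [(a, false)] := by
      rcases List.eq_nil_or_concat g.toWord with h | ⟨V, x, h⟩
      · rw [h] at hr; exact absurd FreeGroup.IsReduced.singleton hr
      · have hx : x = (a, false) := by
          by_contra hx
          apply hr
          rw [h, List.concat_eq_append]
          refine FreeGroup.IsReduced.append_overlap ?_ (L₂ := [x]) ?_ (by simp)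
          · have := FreeGroup.isReduced_toWord (x := g)
            rwa [h, List.concat_eq_append] at this
          · simp only [List.singleton_append, FreeGroup.isReduced_cons_cons]
            refine ⟨fun hxa => ?_, FreeGroup.IsReduced.singleton⟩
            obtain ⟨x1, x2⟩ := x
            simp only at hxa
            subst hxa
            cases x2 <;> simp_all
        subst hx
        exact ⟨V, by simpa using h⟩
    have hgV : g * FreeGroup.of a = FreeGroup.mk V := by
      rw [← FreeGroup.mk_toWord (x := g), hV, ← FreeGroup.mul_mk,
        show FreeGroup.mk [(a, false)] = (FreeGroup.of a)⁻¹ from rfl]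
      group
    have hne : V ≠ [] := by
      rintro rfl
      exact hga hgV
    have := step V (a, false) (hV ▸ FreeGroup.isReduced_toWord) (hV ▸ hgS) hne
    rw [← hV, FreeGroup.mk_toWord] at this
    rw [hgV, this]

/-! ### First syllables in free products -/

namespace Monoid.CoprodI

open Classical in
/-- The index of the first syllable of an element of a free product, or `none` for `1`. -/
noncomputable def firstIdx {ι : Type*} {G : ι → Type*} [∀ i, Group (G i)] (x : CoprodI G) :
    Option ι :=
  (Word.equiv x).fstIdx

variable {ι : Type*} {G : ι → Type*} [∀ i, Group (G i)]

@[simp]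
theorem firstIdx_one : firstIdx (1 : CoprodI G) = none := by
  classical
  have : Word.equiv (1 : CoprodI G) = Word.empty := one_smul (CoprodI G) (Word.empty : Word G)
  rw [firstIdx, this]
  rfl

theorem firstIdx_of_mul {i : ι} (m : G i) (hm : m ≠ 1) (y : CoprodI G)
    (hy : firstIdx y ≠ some i) : firstIdx (of m * y) = some i := by
  classical
  have hy' : (Word.equiv y).fstIdx ≠ some i := by simpa only [firstIdx] using hy
  have h : Word.equiv (of m * y) = Word.cons m (Word.equiv y) hy' hm := by
    rw [Word.cons_eq_smul]
    exact mul_smul (of m) y (Word.empty : Word G)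
  have h' := Word.fstIdx_cons m (Word.equiv y) hy' hm
  rw [← h] at h'
  simpa only [firstIdx] using h'

theorem firstIdx_of {i : ι} (m : G i) (hm : m ≠ 1) : firstIdx (of m) = some i := by
  simpa using firstIdx_of_mul m hm 1 (by simp)

/-- Induction on the normal form of an element of a free product. -/
theorem normalForm_induction {motive : CoprodI G → Prop} (x : CoprodI G) (one : motive 1)
    (of_mul : ∀ (i : ι) (m : G i) (y : CoprodI G), m ≠ 1 → firstIdx y ≠ some i → motive y →
      motive (of m * y)) : motive x := by
  classical
  have h : ∀ w : Word G, motive w.prod := by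
    intro w
    induction w using Word.consRecOn with
    | empty => exact one
    | cons i m w h1 h2 ih =>
      rw [Word.prod_cons]
      refine of_mul i m _ h2 ?_ ih
      have : Word.equiv w.prod = w := Word.equiv.apply_symm_apply w
      rwa [firstIdx, this]
  exact Word.equiv.symm_apply_apply x ▸ h (Word.equiv x)

/-- Only the last syllable can change. If it is also the first, it stays in its factor unless the
whole product cancels. -/
theorem firstIdx_mul_of (x : CoprodI G) {j : ι} (h : G j) (hx : x ≠ 1) (hxh : x * of h ≠ 1) :
    firstIdx (x * of h) = firstIdx x := by
  induction x using normalForm_induction with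
  | one => exact absurd rfl hx
  | of_mul i m y hm hy ih =>
    rw [firstIdx_of_mul m hm y hy]
    by_cases hy1 : y = 1
    · subst hy1
      rw [mul_one] at hxh ⊢
      by_cases hij : j = i
      · subst hij
        rw [← map_mul] at hxh ⊢
        exact firstIdx_of _ fun h' => hxh (by rw [h', map_one])
      · by_cases hh : h = 1
        · simp [hh, firstIdx_of m hm]
        · exact firstIdx_of_mul m hm _ (by simpa [firstIdx_of h hh] using hij)
    · rw [mul_assoc]
      by_cases hyh : y * of h = 1
      · simp [hyh, firstIdx_of m hm]
      · exact firstIdx_of_mul m hm _ (by rwa [ih hy1 hyh])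

/-- For one syllable `m`, only `1` and `m⁻¹` can be exceptions; a product is handled by passing from
`x` to `x * y₁` to `x * y₁ * y₂`. -/
theorem finite_firstIdx_ne (y : CoprodI G) : {x | firstIdx x ≠ firstIdx (x * y)}.Finite := by
  induction y using CoprodI.induction_on with
  | one => simp
  | of i m =>
    refine Set.Finite.subset (Set.toFinite {1, (of m)⁻¹}) fun x hx => ?_
    by_contra hn
    simp only [Set.mem_insert_iff, Set.mem_singleton_iff, not_or] at hn
    exact hx (firstIdx_mul_of x m hn.1 fun h => hn.2 (eq_inv_of_mul_eq_one_left h)).symm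
  | mul y₁ y₂ h₁ h₂ =>
    refine (h₁.union (h₂.preimage (mul_left_injective y₁).injOn)).subset fun x hx => ?_
    by_contra hn
    simp only [Set.mem_union, Set.mem_preimage, Set.mem_ofPred_eq, not_or, not_not] at hn
    exact hx (by rw [hn.1, hn.2, mul_assoc])

end Monoid.CoprodI

/-! ### Generators lie in factors -/

/-- If `Wh(Z rel E_Z)` has no Whitehead cut-vertices and `Z` is contained in the union of the
factors of a free product that contains `E_Z`, then so is `E_Z`. -/
theorem exists_mem_of_no_cutVertex {α ι : Type*} [Finite α] [DecidableEq α]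
    (Z : Set (FreeGroup α)) (hcut : ∀ v : whVertices (supp Z), ¬ IsWhiteheadCutVertex Z (supp Z) v)
    (H : ι → Subgroup (FreeGroup α)) (K : Subgroup (FreeGroup α)) (hH : IsFreeProduct H K)
    (hSK : Subgroup.closure (FreeGroup.of '' supp Z) ≤ K)
    (hZ : Z ⊆ ⋃ i, (H i : Set (FreeGroup α))) {a : α} (ha : a ∈ supp Z) :
    ∃ i, FreeGroup.of a ∈ H i := by
  classical
  obtain ⟨hinj, hrange⟩ := hH
  set f := Monoid.CoprodI.lift fun i => (H i).subtype with hf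
  set S := supp Z with hS
  set F := Subgroup.closure (FreeGroup.of '' S) with hF
  have hsurj : ∀ g ∈ F, ∃ x, f x = g := fun g hg => hrange.ge (hSK hg)
  -- The inverse of `f` on its range, with a default value elsewhere; it is used only where it
  -- inverts `f`.
  let ψ : FreeGroup α → Monoid.CoprodI fun i => H i := Function.invFun f
  have hψ : ∀ g ∈ F, f (ψ g) = g := fun g hg => Function.invFun_eq (hsurj g hg)
  have hψf : ∀ x, ψ (f x) = x := Function.leftInverse_invFun hinj
  have hψmul : ∀ g ∈ F, ∀ h ∈ F, ψ (g * h) = ψ g * ψ h := fun g hg h hh =>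
    hinj (by rw [hψ _ (mul_mem hg hh), map_mul, hψ g hg, hψ h hh])
  have hZF : ∀ z ∈ Z, z ∈ F := fun z hz => (isLeast_supp Z).1 hz
  have hψZ : ∀ z ∈ Z, ∃ i, ∃ m : H i,
      ψ z = (Monoid.CoprodI.of m : Monoid.CoprodI fun i => H i) := by
    intro z hz
    obtain ⟨i, hi⟩ := Set.mem_iUnion.1 (hZ hz)
    refine ⟨i, ⟨z, hi⟩, hinj ?_⟩
    rw [hψ z (hZF z hz), hf, Monoid.CoprodI.lift_of]
    rfl
  have hofF : ∀ b ∈ S, FreeGroup.of b ∈ F := fun b hb => Subgroup.subset_closure ⟨b, hb, rfl⟩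
  have hfin : ∀ w : Monoid.CoprodI fun i => H i, ∀ h ∈ F,
      {g | g ∈ F ∧ (w * ψ g).firstIdx ≠ (w * ψ (g * h)).firstIdx}.Finite := by
    intro w h hh
    refine Set.Finite.of_finite_image ((Monoid.CoprodI.finite_firstIdx_ne (ψ h)).subset ?_)
      (f := fun g => w * ψ g) ?_
    · rintro _ ⟨g, ⟨hg, hne⟩, rfl⟩
      rwa [hψmul g hg h hh, ← mul_assoc] at hne
    · rintro g ⟨hg, -⟩ g' ⟨hg', -⟩ h
      rw [← hψ g hg, ← hψ g' hg', mul_left_cancel h]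
  -- the first syllable of `w * g` does not change along edges in `F` where it is defined
  have hconst : ∀ w : Monoid.CoprodI fun i => H i, (∀ g ∈ F, g ≠ 1 → w * ψ g ≠ 1) → ∀ g ∈ F,
      g ≠ 1 → g * FreeGroup.of a ≠ 1 →
      (w * ψ g).firstIdx = (w * ψ (g * FreeGroup.of a)).firstIdx := by
    intro w hw g hg hg1 hga
    refine eq_mul_of_of_no_cutVertex Z hcut (fun g => (w * ψ g).firstIdx) (hfin w) ?_ hg ha hg1 hga
    intro z hz g hg hg1 hgz
    obtain ⟨i, m, hm⟩ := hψZ z hz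
    have h2 := hw _ (mul_mem hg (hZF z hz)) hgz
    rw [hψmul g hg z (hZF z hz), hm, ← mul_assoc] at h2 ⊢
    exact (Monoid.CoprodI.firstIdx_mul_of _ _ (hw g hg hg1) h2).symm
  have haF := hofF a ha
  have ha1 : FreeGroup.of a ≠ 1 := FreeGroup.of_ne_one a
  have hfa := hψ _ haF
  generalize hy : ψ (FreeGroup.of a) = y at hfa
  induction y using Monoid.CoprodI.normalForm_induction with
  | one => exact absurd (by simpa using hfa.symm) ha1
  | of_mul i m y hm hyi _ =>
    by_cases hy1 : y = 1
    · refine ⟨i, ?_⟩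
      rw [← hfa, hy1, mul_one, hf, Monoid.CoprodI.lift_of]
      exact m.2
    exfalso
    have hmi : (Monoid.CoprodI.of m⁻¹ : Monoid.CoprodI fun i => H i).firstIdx = some i :=
      Monoid.CoprodI.firstIdx_of _ (inv_ne_one.2 hm)
    -- Since `a = m * y`, passing from `m⁻¹` to `m⁻¹ * a = y` changes the first index. If `m⁻¹ ∈ F`,
    -- this is an edge of `F` and `w = 1` works. Otherwise `w = m⁻¹ * a⁻¹` turns it into the edge
    -- from `a` to `a²`, and `w * g = 1` with `g ∈ F` would put `m⁻¹` in `F`.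
    by_cases hmF : f (Monoid.CoprodI.of m⁻¹) ∈ F
    · have h1 : f (Monoid.CoprodI.of m⁻¹) ≠ 1 := by
        rw [← map_one f]
        intro h
        simp [hinj h] at hmi
      have h2 : f (Monoid.CoprodI.of m⁻¹) * FreeGroup.of a = f y := by
        rw [← hfa, ← map_mul, ← mul_assoc, ← map_mul]
        simp
      have h3 := hconst 1 (fun g hg hg1 h => hg1 (by
          rw [← hψ g hg, ← map_one f]; rw [one_mul] at h; rw [h])) _ hmF h1 (by
        rw [h2, ← map_one f]; exact fun h => hy1 (hinj h))
      rw [h2, one_mul, one_mul, hψf, hψf, hmi] at h3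
      exact hyi h3.symm
    · have key := hconst ((Monoid.CoprodI.of m⁻¹ : Monoid.CoprodI fun i => H i) * (ψ (FreeGroup.of a))⁻¹) (fun g hg _ h => by
          apply hmF
          have h' := congrArg f h
          rw [map_mul, map_mul, map_inv f (ψ _), hψ _ haF, hψ g hg, map_one, mul_assoc] at h'
          rw [eq_inv_of_mul_eq_one_left h']
          exact inv_mem (mul_mem (inv_mem haF) hg)) (FreeGroup.of a) haF ha1 (by
            intro h
            have := congrArg FreeGroup.norm h
            rw [← pow_two, FreeGroup.norm_of_pow] at this
            simp at this)
      rw [hψmul _ haF _ haF, mul_assoc, mul_assoc, inv_mul_cancel_left, inv_mul_cancel, mul_one,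
        hmi, hy, ← mul_assoc, ← map_mul] at key
      simp at key
      exact hyi key.symm

/-! ### Retractions and standard factors -/

/-- A factor of a free product is a retract, by a retraction that kills the other factors. -/
theorem IsFreeProduct.exists_retraction {G ι : Type*} [Group G] {H : ι → Subgroup G}
    {K : Subgroup G} (h : IsFreeProduct H K) (i : ι) :
    ∃ ρ : K →* G, (∀ x (hx : x ∈ K), x ∈ H i → ρ ⟨x, hx⟩ = x) ∧
      ∀ j ≠ i, ∀ x (hx : x ∈ K), x ∈ H j → ρ ⟨x, hx⟩ = 1 := by
  classical
  obtain ⟨hinj, rfl⟩ := h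
  let r : (Monoid.CoprodI fun i => H i) →* H i :=
    Monoid.CoprodI.lift fun j => if hj : j = i then hj ▸ MonoidHom.id (H j) else 1
  have hsymm : ∀ j x (hx : x ∈ (Monoid.CoprodI.lift fun i => (H i).subtype).range) (hxj : x ∈ H j),
      (MonoidHom.ofInjective hinj).symm ⟨x, hx⟩ =
        (Monoid.CoprodI.of (⟨x, hxj⟩ : H j) : Monoid.CoprodI fun i => H i) := by
    intro j x hx hxj
    rw [MulEquiv.symm_apply_eq]
    ext
    exact (Monoid.CoprodI.lift_of (fun i => (H i).subtype) (⟨x, hxj⟩ : H j)).symm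
  refine ⟨(H i).subtype.comp (r.comp (MonoidHom.ofInjective hinj).symm.toMonoidHom),
    fun x hx hxi => ?_, fun j hj x hx hxj => ?_⟩
  · simp [hsymm i x hx hxi, r]
  · simp [hsymm j x hx hxj, r, hj]

/-- If a set `S` is contained in the union of the factors of a free product, then `⟨S⟩` meets each
factor in the subgroup generated by the elements of `S` in that factor. -/
theorem IsFreeProduct.mem_closure_inter {G ι : Type*} [Group G] {H : ι → Subgroup G}
    {K : Subgroup G} (h : IsFreeProduct H K) {S : Set G} (hSK : Subgroup.closure S ≤ K)
    (hS : ∀ s ∈ S, ∃ j, s ∈ H j) {i : ι} {x : G} (hx : x ∈ Subgroup.closure S) (hxi : x ∈ H i) :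
    x ∈ Subgroup.closure (S ∩ H i) := by
  obtain ⟨ρ, hρi, hρj⟩ := h.exists_retraction i
  -- Replacing `x` by `ρ x` lets the induction run over all of `⟨S⟩`, without requiring membership
  -- in `H i`.
  rw [← hρi x (hSK hx) hxi]
  clear hxi
  induction hx using Subgroup.closure_induction with
  | mem s hs =>
    obtain ⟨j, hj⟩ := hS s hs
    by_cases hji : j = i
    · subst hji
      rw [hρi s _ hj]
      exact Subgroup.subset_closure ⟨hs, hj⟩
    · rw [hρj j hji s _ hj]
      exact one_mem _
  | one => exact (map_one ρ).symm ▸ one_mem _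
  | mul x y hx hy ihx ihy =>
    have := mul_mem ihx ihy
    rwa [← map_mul] at this
  | inv x hx ih =>
    have := inv_mem ih
    rwa [← map_inv] at this

/-- A partition of a basis of a free group yields a free-product factorization. -/
theorem isFreeProduct_closure_preimage {α ι : Type*} (p : α → ι) :
    IsFreeProduct (fun i => Subgroup.closure (FreeGroup.of '' (p ⁻¹' {i}))) ⊤ := by
  let H : ι → Subgroup (FreeGroup α) := fun i => Subgroup.closure (FreeGroup.of '' (p ⁻¹' {i}))
  let θ : FreeGroup α →* Monoid.CoprodI fun i => H i := FreeGroup.lift fun a =>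
    (Monoid.CoprodI.of (⟨FreeGroup.of a, Subgroup.subset_closure ⟨a, rfl, rfl⟩⟩ : H (p a)) :
      Monoid.CoprodI fun i => H i)
  have hθ : ∀ i, ∀ x (hx : x ∈ H i), θ x = (Monoid.CoprodI.of (⟨x, hx⟩ : H i) :
      Monoid.CoprodI fun i => H i) := by
    intro i x hx
    induction hx using Subgroup.closure_induction with
    | mem x hx =>
      obtain ⟨a, rfl, rfl⟩ := hx
      exact FreeGroup.lift_apply_of
    | one => rw [map_one]; exact (map_one _).symm
    | mul x y hx hy ihx ihy =>
      rw [map_mul, ihx, ihy, ← map_mul]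
      rfl
    | inv x hx ih =>
      rw [map_inv, ih, ← map_inv]
      rfl
  refine ⟨Function.LeftInverse.injective (g := θ) fun x => ?_, ?_⟩
  · have : θ.comp (Monoid.CoprodI.lift fun i => (H i).subtype) = MonoidHom.id _ := by
      refine Monoid.CoprodI.ext_hom _ _ fun i => MonoidHom.ext fun x => ?_
      simp only [MonoidHom.comp_apply, Monoid.CoprodI.lift_of, MonoidHom.id_apply]
      exact hθ i x x.2
    exact DFunLike.congr_fun this x
  · rw [eq_top_iff, ← FreeGroup.closure_range_of, Subgroup.closure_le]
    rintro _ ⟨a, rfl⟩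
    refine ⟨Monoid.CoprodI.of
      (⟨FreeGroup.of a, Subgroup.subset_closure ⟨a, rfl, rfl⟩⟩ : H (p a)), ?_⟩
    rw [Monoid.CoprodI.lift_of]
    rfl

theorem isFreeFactor_closure {α : Type*} (S : Set α) :
    IsFreeFactor (Subgroup.closure (FreeGroup.of '' S)) := by
  classical
  refine ⟨Subgroup.closure (FreeGroup.of '' Sᶜ), ?_⟩
  convert isFreeProduct_closure_preimage (fun a => if a ∈ S then (0 : Fin 2) else 1) using 1
  funext i
  fin_cases i
  · simp only [Fin.zero_eta, Matrix.cons_val_zero]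
    congr 2
    ext a
    simp
  · simp only [Fin.mk_one, Matrix.cons_val_one, Matrix.cons_val_zero]
    congr 2
    ext a
    simp

/-- A subset of the standard basis is a basis of the subgroup that it generates. -/
theorem isBasisOf_closure {α : Type*} (S : Set α) :
    IsBasisOf (FreeGroup.of '' S) (Subgroup.closure (FreeGroup.of '' S)) := by
  classical
  refine ⟨?_, ?_⟩
  · let θ : FreeGroup α →* FreeGroup (FreeGroup.of '' S) :=
      FreeGroup.lift fun a => if ha : a ∈ S then FreeGroup.of ⟨FreeGroup.of a, a, ha, rfl⟩ else 1
    refine Function.LeftInverse.injective (g := θ) fun x => ?_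
    have : θ.comp (FreeGroup.lift fun b : FreeGroup.of '' S => (b : FreeGroup α)) =
        MonoidHom.id _ := by
      ext ⟨_, a, ha, rfl⟩
      simp [θ, ha]
    exact DFunLike.congr_fun this x
  · rw [FreeGroup.range_lift_eq_closure, Subtype.range_coe]

/-! ### The closure and its factorizations -/

theorem mainTheorem2 {α : Type*} [Finite α] [DecidableEq α]
    (Z : Set (FreeGroup α)) (hZ : Z.Finite)
    (hcut : ∀ v : whVertices (supp Z), ¬ IsWhiteheadCutVertex Z (supp Z) v) :
    IsLeast {K : Subgroup (FreeGroup α) | IsFreeFactor K ∧ Z ⊆ K} (freeClosure Z) ∧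
    IsBasisOf (suppBasis Z) (freeClosure Z) ∧
    ∀ (ι : Type*) (H : ι → Subgroup (FreeGroup α)),
      IsFreeProduct H (freeClosure Z) → Z ⊆ ⋃ i, (H i : Set (FreeGroup α)) →
        ∀ i, ∃ B ⊆ suppBasis Z, IsBasisOf B (H i) := by
  have hleast : IsLeast {K : Subgroup (FreeGroup α) | IsFreeFactor K ∧ Z ⊆ K}
      (Subgroup.closure (FreeGroup.of '' supp Z)) := by
    refine ⟨⟨isFreeFactor_closure _, (isLeast_supp Z).1⟩, ?_⟩
    rintro K ⟨⟨L, hKL⟩, hZK⟩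
    have hmem : ∀ a ∈ supp Z, ∃ i, FreeGroup.of a ∈ ![K, L] i := fun a ha =>
      exists_mem_of_no_cutVertex Z hcut _ _ hKL le_top
        (fun z hz => Set.mem_iUnion.2 ⟨0, hZK hz⟩) ha
    -- The generators lying in `K` already generate a subgroup containing `Z`, so minimality of the
    -- support applies.
    have hS : supp Z ⊆ supp Z ∩ FreeGroup.of ⁻¹' K := by
      refine (isLeast_supp Z).2 fun z hz => ?_
      rw [Set.image_inter_preimage]
      refine hKL.mem_closure_inter le_top ?_ ((isLeast_supp Z).1 hz) (i := 0) (hZK hz)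
      rintro _ ⟨a, ha, rfl⟩
      exact hmem a ha
    rw [Subgroup.closure_le]
    rintro _ ⟨a, ha, rfl⟩
    exact (hS ha).2
  have hCl : freeClosure Z = Subgroup.closure (FreeGroup.of '' supp Z) :=
    le_antisymm (sInf_le hleast.1) (le_sInf fun K hK => hleast.2 hK)
  rw [hCl]
  refine ⟨hleast, isBasisOf_closure _, fun ι H hH hZH i => ?_⟩
  have hmem : ∀ a ∈ supp Z, ∃ j, FreeGroup.of a ∈ H j := fun a ha =>
    exists_mem_of_no_cutVertex Z hcut H _ hH le_rfl hZH ha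
  have hHi : H i ≤ Subgroup.closure (FreeGroup.of '' supp Z) := by
    intro x hx
    rw [← hH.2]
    exact ⟨Monoid.CoprodI.of (⟨x, hx⟩ : H i), by rw [Monoid.CoprodI.lift_of]; rfl⟩
  refine ⟨FreeGroup.of '' supp Z ∩ H i, Set.inter_subset_left, ?_⟩
  have hB := isBasisOf_closure (supp Z ∩ FreeGroup.of ⁻¹' (H i : Set (FreeGroup α)))
  rw [Set.image_inter_preimage] at hB
  convert hB using 1
  refine le_antisymm (fun x hx => hH.mem_closure_inter le_rfl ?_ (hHi hx) hx) ?_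
  · rintro _ ⟨a, ha, rfl⟩
    exact hmem a ha
  · rw [Subgroup.closure_le]
    exact Set.inter_subset_right
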